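/- Let $D=\langle(\vec x_i,c_i)\rangle_{0\le i<N}$ with $N=2^n$ be a training set, $\vec x_i\in\mathbb R^k$, $c_i\in\{0,1\}$. For $\vec w\in\mathbb R^k$, $b\in\mathbb R$ let $f_{\vec w,b}(\vec x)=1$ if $\vec w\cdot\vec x+b>0$ and $f_{\vec w,b}(\vec x)=0$ otherwise. The original perceptron algorithm starts with $\vec w=0$, $b=0$ and repeats the following loop until an entire loop makes no update: for $i=0,\dots,N-1$, put $d=f_{\vec w,b}(\vec x_i)$ and, if $d\ne c_i$, update $\vec w\leftarrow\vec w+(c_i-d)\vec x_i$, $b\leftarrow b+(c_i-d)$. The noisy perceptron algorithm starts with $\vec w=0$, $b=0$ and repeats the following loop until an entire loop makes no update: draw $u\in\{0,1\}^n$ uniformly at random; for $i=0,\dots,N-1$, draw a noise vector $\vec r\in\mathbb R^k$, put $j=i\oplus u$ (bitwise XOR) and $d=f_{\vec w,b}(\vec x_j)$ and, if $d\ne c_j$, update $\vec w\leftarrow\vec w+(c_j-d)(\vec x_j+\vec r)$, $b\leftarrow b+(c_j-d)$. All noise vectors are drawn from one and the same probability law on $\mathbb R^k$, which is integrable with mean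 $0$ and otherwise arbitrary, and all the random draws (strings $u$ and vectors $\vec r$) are independent. Theorem. If the original perceptron algorithm terminates on $D$, then the noisy perceptron algorithm terminates on $D$ with probability one (that is, almost surely some loop makes no update), and whenever it terminates, the classifier $f_{\vec w,b}$ given by its final $\vec w$ and $b$ is correct on $D$: $f_{\vec w,b}(\vec x_i)=c_i$ for all $i$. -/

import Mathlib

open MeasureTheory ProbabilityTheory

noncomputable section

namespace NoisyPerceptron

/-- A training set of `N` examples: training vectors `x i ∈ ℝᵏ` with classes `c i ∈ {0,1}`. -/
structure TrainingSet (k N : ℕ) where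
  x : Fin N → EuclideanSpace ℝ (Fin k)
  c : Fin N → Fin 2

/-- The weights `w` and the bias `b` of a linear classifier on `ℝᵏ`. -/
@[ext]
structure Params (k : ℕ) where
  w : EuclideanSpace ℝ (Fin k)
  b : ℝ

/-- The classifier `f(x) = 1` if `w · x + b > 0`, and `f(x) = 0` otherwise. -/
def Params.classify {k : ℕ} (p : Params k) (x : EuclideanSpace ℝ (Fin k)) : Fin 2 :=
  open Classical in if 0 < inner ℝ p.w x + p.b then 1 else 0

/-- `p` classifies every example of `D` correctly. -/
def Params.Correct {k N : ℕ} (p : Params k) (D : TrainingSet k N) : Prop :=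
  ∀ i, p.classify (D.x i) = D.c i

/-- The variables inside one loop over the training set: the current parameters and the number
`Δ` of updates made so far in this loop. -/
structure LoopState (k : ℕ) where
  params : Params k
  Δ : ℕ

/-- The processing of one example: compute `d = f(x)` on the true vector `x`; if `d ≠ c`, count one update and
set `w ← w + (c - d) x'` and `b ← b + (c - d)`, where `x'` is the vector used for the update. -/
def step {k : ℕ} (s : LoopState k) (x x' : EuclideanSpace ℝ (Fin k)) (c : Fin 2) : LoopState k :=
  let d := s.params.classify x
  if d ≠ c then
    { params :=
        { w := s.params.w + (((c : ℕ) : ℝ) - ((d : ℕ) : ℝ)) • x'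
          b := s.params.b + (((c : ℕ) : ℝ) - ((d : ℕ) : ℝ)) }
      Δ := s.Δ + 1 }
  else s

/-- One loop of the original perceptron: the examples are visited in order, and updates use the
training vectors themselves. -/
def originalLoop {k N : ℕ} (D : TrainingSet k N) (p : Params k) : LoopState k :=
  (List.finRange N).foldl (fun s i => step s (D.x i) (D.x i) (D.c i)) ⟨p, 0⟩

/-- One loop of the noisy perceptron. The indices are the `n`-bit numbers; at inner iteration `i`
the example `i ⊕ u` (bitwise XOR) is used, tested on its true vector `x (i ⊕ u)` and, if
misclassified, used for an update in the distorted form `x (i ⊕ u) + r i`. -/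
def noisyLoop {k n : ℕ} (D : TrainingSet k (2 ^ n)) (u : Fin (2 ^ n))
    (r : Fin (2 ^ n) → EuclideanSpace ℝ (Fin k)) (p : Params k) : LoopState k :=
  (List.finRange (2 ^ n)).foldl
    (fun s i => step s (D.x (i ^^^ u)) (D.x (i ^^^ u) + r i) (D.c (i ^^^ u))) ⟨p, 0⟩

/-- The state of an algorithm between loops; `halted` says that it has left by `break`, i.e. that
some executed loop made no update. -/
structure RunState (k : ℕ) where
  params : Params k
  halted : Bool

/-- Starting from `w = 0`, `b = 0`, execute the loops `loop 0, loop 1, …`, stopping after the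
first one that makes no update, and executing at most `T` of them. The returned classifier is the
field `params`. -/
def runLoops {k : ℕ} (loop : ℕ → Params k → LoopState k) : ℕ → RunState k
  | 0 => ⟨⟨0, 0⟩, false⟩
  | T + 1 =>
    let s := runLoops loop T
    if s.halted then s
    else
      let q := loop T s.params
      ⟨q.params, decide (q.Δ = 0)⟩

/-- The original perceptron algorithm, cut off after at most `T` loops. -/
def originalRun {k N : ℕ} (D : TrainingSet k N) (T : ℕ) : RunState k :=
  runLoops (fun _ => originalLoop D) T

/-- The noisy perceptron algorithm with the upper bound `T` for the number of loops; `u m` is the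
bit string drawn in loop `m` and `r m i` the noise vector drawn at iteration `i` of loop `m`. -/
def noisyRun {k n : ℕ} (D : TrainingSet k (2 ^ n)) (u : ℕ → Fin (2 ^ n))
    (r : ℕ → Fin (2 ^ n) → EuclideanSpace ℝ (Fin k)) (T : ℕ) : RunState k :=
  runLoops (fun m => noisyLoop D (u m) (r m)) T

end NoisyPerceptron

end

/-! Termination of the original run yields a correct classifier, hence after a small shift of the
bias a separator with margin γ > 0. Suppose the noisy run never halts. Every loop then makes an
update, so `m` loops make at least `m` updates. Let S be the noise accumulated in the weights, that
is, the sum of error times noise vector, and set v = w - S. The classical perceptron estimates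
survive for (v, b): each update raises its inner product with the separator by at least γ, while
|v|² + b² grows per example by at most 2R|S| + R² + 1, where R bounds the training vectors. If |S| =
o(q) after q examples, Cauchy-Schwarz gives γ²m² ≤ o(m²), a contradiction
(`not_forall_le_sum_abs_errorSeq`).

That S is almost surely sublinear is a law of large numbers (`ae_tendsto_sum_predictable_div`): each
error is determined before its noise vector is drawn, so S is coordinatewise a predictable transform
of centred i.i.d. variables. Since only integrability is assumed, the variables are truncated. The
bounded part is handled by orthogonality and second moments along squares, the tail by the usual
strong law for absolute values.

Correctness is separate: a loop without updates has tested every example, because XOR with a fixed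
string is a permutation. -/

open Filter Topology

/-! ### Laws of large numbers for predictable transforms -/

/-- The second moment of a predictable transform of bounded centred variables grows linearly. -/
lemma integral_sq_sum_predictable_le {Ω : Type*} [mΩ : MeasurableSpace Ω] {μ : Measure Ω}
    [IsProbabilityMeasure μ] {m : ℕ → MeasurableSpace Ω} (hm : ∀ n, m n ≤ mΩ) (hmono : Monotone m)
    {A Z : ℕ → Ω → ℝ} (hA : ∀ n, Measurable[m n] (A n)) (hZ : ∀ n, Measurable[m (n + 1)] (Z n))
    (hind : ∀ n, Indep (m n) (MeasurableSpace.comap (Z n) inferInstance) μ)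
    (hA1 : ∀ n ω, |A n ω| ≤ 1) {C : ℝ} (hZC : ∀ n ω, |Z n ω| ≤ C) (hmean : ∀ n, ∫ ω, Z n ω ∂μ = 0)
    (n : ℕ) :
    Integrable (fun ω => (∑ i ∈ Finset.range n, A i ω * Z i ω) ^ 2) μ ∧
    ∫ ω, (∑ i ∈ Finset.range n, A i ω * Z i ω) ^ 2 ∂μ ≤ C ^ 2 * n := by
  have hC : 0 ≤ C := by
    obtain ⟨ω⟩ := nonempty_of_isProbabilityMeasure μ
    exact (abs_nonneg _).trans (hZC 0 ω)
  have hAZ : ∀ i ω, |A i ω * Z i ω| ≤ C := fun i ω => by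
    rw [abs_mul]
    calc |A i ω| * |Z i ω| ≤ 1 * C := by gcongr; exacts [hA1 i ω, hZC i ω]
      _ = C := one_mul C
  set S : ℕ → Ω → ℝ := fun n ω => ∑ i ∈ Finset.range n, A i ω * Z i ω with hS
  have hSm : ∀ n, Measurable[m n] (S n) := fun n => by
    refine @Finset.measurable_fun_sum ℝ ℕ Ω _ _ _ (m n) _ _ fun i hi => ?_
    have hi := Finset.mem_range.1 hi
    exact Measurable.fun_mul (m := m n) ((hA i).mono (hmono hi.le) le_rfl)
      ((hZ i).mono (hmono hi) le_rfl)
  have hSb : ∀ n ω, |S n ω| ≤ n * C := fun n ω => by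
    calc |S n ω| ≤ ∑ i ∈ Finset.range n, |A i ω * Z i ω| := Finset.abs_sum_le_sum_abs _ _
      _ ≤ ∑ i ∈ Finset.range n, C := Finset.sum_le_sum fun i _ => hAZ i ω
      _ = n * C := by simp
  have hZm : ∀ n, Measurable (Z n) := fun n => (hZ n).mono (hm _) le_rfl
  have hAm : ∀ n, Measurable (A n) := fun n => (hA n).mono (hm _) le_rfl
  have hSm' : ∀ n, Measurable (S n) := fun n => (hSm n).mono (hm _) le_rfl
  have hint : ∀ n, Integrable (fun ω => S n ω ^ 2) μ := fun n =>
    Integrable.of_bound ((hSm' n).pow_const 2).aestronglyMeasurable ((n * C) ^ 2)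
      (Eventually.of_forall fun ω => by
        rw [Real.norm_eq_abs, abs_pow]
        exact pow_le_pow_left₀ (abs_nonneg _) (hSb n ω) 2)
  refine ⟨hint n, ?_⟩
  induction n with
  | zero => simp
  | succ n ih =>
    -- Orthogonality of increments: `S n * A n` is known at time `n`, and `Z n` is centred and
    -- independent of `m n`.
    have hcross : ∫ ω, (S n ω * A n ω) * Z n ω ∂μ = 0 := by
      have hi : IndepFun (fun ω => S n ω * A n ω) (Z n) μ := by
        rw [IndepFun_iff_Indep]
        exact indep_of_indep_of_le_left (hind n)
          (Measurable.fun_mul (m := m n) (hSm n) (hA n)).comap_le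
      rw [hi.integral_fun_mul_eq_mul_integral ((hSm' n).mul (hAm n)).aestronglyMeasurable
        (hZm n).aestronglyMeasurable, hmean, mul_zero]
    have hcint : Integrable (fun ω => (S n ω * A n ω) * Z n ω) μ :=
      Integrable.of_bound (((hSm' n).mul (hAm n)).mul (hZm n)).aestronglyMeasurable ((n * C) * C)
        (Eventually.of_forall fun ω => by
          rw [Real.norm_eq_abs, mul_assoc, abs_mul]
          exact mul_le_mul (hSb n ω) (hAZ n ω) (abs_nonneg _) (by positivity))
    calc ∫ ω, S (n + 1) ω ^ 2 ∂μ
        ≤ ∫ ω, (S n ω ^ 2 + 2 * ((S n ω * A n ω) * Z n ω) + C ^ 2) ∂μ := by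
          refine integral_mono (hint _) (((hint n).add (hcint.const_mul 2)).add
            (integrable_const _)) fun ω => ?_
          have h1 : S (n + 1) ω = S n ω + A n ω * Z n ω := Finset.sum_range_succ _ _
          have h2 : (A n ω * Z n ω) ^ 2 ≤ C ^ 2 := sq_le_sq' (abs_le.1 (hAZ n ω)).1
            (abs_le.1 (hAZ n ω)).2
          simp only [h1]
          nlinarith
      _ = ∫ ω, S n ω ^ 2 ∂μ + 2 * 0 + C ^ 2 := by
          rw [integral_add (f := fun ω => S n ω ^ 2 + 2 * ((S n ω * A n ω) * Z n ω))
              ((hint n).add (hcint.const_mul 2)) (integrable_const _),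
            integral_add (hint n) (hcint.const_mul 2), integral_const_mul, hcross]
          simp
      _ ≤ C ^ 2 * (n + 1 : ℕ) := by push_cast; linarith

/-- Random variables whose second moments are summable tend to zero almost surely. -/
lemma ae_tendsto_zero_of_summable_integral_sq {Ω : Type*} [MeasurableSpace Ω] {μ : Measure Ω}
    {X : ℕ → Ω → ℝ} (hint : ∀ n, Integrable (fun ω => X n ω ^ 2) μ)
    (hsum : Summable fun n => ∫ ω, X n ω ^ 2 ∂μ) :
    ∀ᵐ ω ∂μ, Tendsto (fun n => X n ω) atTop (𝓝 0) := by
  -- By Tonelli the sum of squares has finite expectation, so it is almost surely finite.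
  have hlt : ∫⁻ ω, ∑' n, ENNReal.ofReal (X n ω ^ 2) ∂μ ≠ ⊤ := by
    rw [lintegral_tsum fun n => (hint n).aemeasurable.ennreal_ofReal]
    simp_rw [← ofReal_integral_eq_lintegral_ofReal (hint _) (Eventually.of_forall fun ω => sq_nonneg _)]
    exact hsum.tsum_ofReal_ne_top
  have hmeas : AEMeasurable (fun ω => ∑' n, ENNReal.ofReal (X n ω ^ 2)) μ :=
    AEMeasurable.tsum fun n => (hint n).aemeasurable.ennreal_ofReal
  filter_upwards [ae_lt_top' hmeas hlt] with ω hω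
  have h0 := ENNReal.tendsto_atTop_zero_of_tsum_ne_top hω.ne
  have h1 : Tendsto (fun n => X n ω ^ 2) atTop (𝓝 0) := by
    have := (ENNReal.tendsto_toReal ENNReal.zero_ne_top).comp h0
    simpa [Function.comp_def, ENNReal.toReal_ofReal, sq_nonneg] using this
  rw [tendsto_zero_iff_abs_tendsto_zero]
  have := (Real.continuous_sqrt.tendsto 0).comp h1
  simpa [Function.comp_def, Real.sqrt_sq_eq_abs] using this

/-- Averages with bounded increments converge to zero if they do so along the squares. -/
lemma tendsto_div_zero_of_tendsto_along_squares {S : ℕ → ℝ} {C : ℝ}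
    (hS : ∀ n, |S (n + 1) - S n| ≤ C)
    (h : Tendsto (fun k : ℕ => S (k ^ 2) / (k : ℝ) ^ 2) atTop (𝓝 0)) :
    Tendsto (fun n : ℕ => S n / n) atTop (𝓝 0) := by
  have hC : 0 ≤ C := (abs_nonneg _).trans (hS 0)
  have hinc : ∀ a b, |S (a + b) - S a| ≤ b * C := fun a b => by
    induction b with
    | zero => simp
    | succ b ih =>
      calc |S (a + (b + 1)) - S a| = |(S (a + b + 1) - S (a + b)) + (S (a + b) - S a)| := by
            rw [← add_assoc]; ring_nf
        _ ≤ |S (a + b + 1) - S (a + b)| + |S (a + b) - S a| := abs_add_le _ _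
        _ ≤ ((b + 1 : ℕ) : ℝ) * C := by push_cast; linarith [hS (a + b)]
  have hsqrt : Tendsto Nat.sqrt atTop atTop :=
    tendsto_atTop_atTop.2 fun b => ⟨b * b, fun a ha => Nat.le_sqrt.2 ha⟩
  have hlim : Tendsto (fun k : ℕ => |S (k ^ 2) / (k : ℝ) ^ 2| + 2 * C / k) atTop (𝓝 0) := by
    simpa using h.abs.add (tendsto_const_div_atTop_nhds_zero_nat (2 * C))
  refine squeeze_zero_norm' ?_ (hlim.comp hsqrt)
  filter_upwards [eventually_ge_atTop 1] with n hn
  simp only [Function.comp_apply, Real.norm_eq_abs]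
  set k := Nat.sqrt n with hk
  have hk1 : 1 ≤ k := Nat.le_sqrt.2 (by simpa using hn)
  have hkn : k ^ 2 ≤ n := Nat.sqrt_le' n
  -- Consecutive squares differ by 2k + 1, so filling the gap costs at most 2kC, which is negligible
  -- against k².
  have hnk : n - k ^ 2 ≤ 2 * k := by
    have : n ≤ k * k + k + k := Nat.sqrt_le_add n
    have h2 : k ^ 2 = k * k := sq k
    omega
  have hkpos : (0 : ℝ) < k := by exact_mod_cast hk1
  have hkn' : (k : ℝ) ^ 2 ≤ n := by exact_mod_cast hkn
  have hb : |S n - S (k ^ 2)| ≤ 2 * k * C := by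
    have h1 := hinc (k ^ 2) (n - k ^ 2)
    rw [Nat.add_sub_cancel' hkn] at h1
    have h2 : ((n - k ^ 2 : ℕ) : ℝ) ≤ 2 * k := by exact_mod_cast hnk
    exact h1.trans (by gcongr)
  have hb' : |S n| ≤ |S (k ^ 2)| + 2 * k * C := by
    have := abs_sub_abs_le_abs_sub (S n) (S (k ^ 2))
    linarith
  calc |S n / n| = |S n| / n := by rw [abs_div, Nat.abs_cast]
    _ ≤ (|S (k ^ 2)| + 2 * k * C) / (k : ℝ) ^ 2 := by gcongr
    _ = |S (k ^ 2) / (k : ℝ) ^ 2| + 2 * C / k := by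
        rw [abs_div, abs_of_pos (by positivity : (0 : ℝ) < (k : ℝ) ^ 2)]
        field_simp

/-- The law of large numbers for predictable transforms of bounded centred variables. -/
lemma ae_tendsto_sum_predictable_div_of_bounded {Ω : Type*} [mΩ : MeasurableSpace Ω] {μ : Measure Ω}
    [IsProbabilityMeasure μ] {m : ℕ → MeasurableSpace Ω} (hm : ∀ n, m n ≤ mΩ) (hmono : Monotone m)
    {A Z : ℕ → Ω → ℝ} (hA : ∀ n, Measurable[m n] (A n)) (hZ : ∀ n, Measurable[m (n + 1)] (Z n))
    (hind : ∀ n, Indep (m n) (MeasurableSpace.comap (Z n) inferInstance) μ)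
    (hA1 : ∀ n ω, |A n ω| ≤ 1) {C : ℝ} (hZC : ∀ n ω, |Z n ω| ≤ C)
    (hmean : ∀ n, ∫ ω, Z n ω ∂μ = 0) :
    ∀ᵐ ω ∂μ, Tendsto (fun n : ℕ => (∑ i ∈ Finset.range n, A i ω * Z i ω) / n) atTop (𝓝 0) := by
  have hmom := integral_sq_sum_predictable_le hm hmono hA hZ hind hA1 hZC hmean
  -- At time k² the average has second moment at most C²/k², which is summable.
  have hsq : ∀ᵐ ω ∂μ, Tendsto (fun k : ℕ =>
      (∑ i ∈ Finset.range (k ^ 2), A i ω * Z i ω) / (k : ℝ) ^ 2) atTop (𝓝 0) := by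
    refine ae_tendsto_zero_of_summable_integral_sq (fun k => ?_) ?_
    · simp_rw [div_pow]
      exact (hmom _).1.div_const _
    · have hs : Summable fun k : ℕ => C ^ 2 * (1 / (k : ℝ) ^ 2) :=
        (Real.summable_one_div_nat_pow.2 one_lt_two).mul_left _
      refine Summable.of_nonneg_of_le (fun k => integral_nonneg fun ω => sq_nonneg _)
        (fun k => ?_) hs
      simp_rw [div_pow]
      rw [integral_div]
      rcases Nat.eq_zero_or_pos k with rfl | hk
      · simp
      · have hk' : (0 : ℝ) < k := by exact_mod_cast hk
        rw [div_le_iff₀ (by positivity)]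
        refine (hmom (k ^ 2)).2.trans (le_of_eq ?_)
        push_cast
        field_simp
  filter_upwards [hsq] with ω hω
  refine tendsto_div_zero_of_tendsto_along_squares (C := C) (fun n => ?_) hω
  rw [Finset.sum_range_succ, add_sub_cancel_left, abs_mul]
  calc |A n ω| * |Z n ω| ≤ 1 * C := by gcongr; exacts [hA1 n ω, hZC n ω]
    _ = C := one_mul C

/-- If `m₁` is independent of `m₂ ⊔ m₃` and `m₂` of `m₃`, then `m₁ ⊔ m₂` is independent of `m₃`. -/
lemma indep_sup_left_of_indep {Ω : Type*} {m₁ m₂ m₃ : MeasurableSpace Ω} [mΩ : MeasurableSpace Ω]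
    {μ : Measure Ω} [IsProbabilityMeasure μ] (h₁ : m₁ ≤ mΩ) (h₂ : m₂ ≤ mΩ) (h₃ : m₃ ≤ mΩ)
    (h : Indep m₁ (m₂ ⊔ m₃) μ) (h' : Indep m₂ m₃ μ) : Indep (m₁ ⊔ m₂) m₃ μ := by
  set p : Set (Set Ω) := {s | ∃ a b, MeasurableSet[m₁] a ∧ MeasurableSet[m₂] b ∧ s = a ∩ b} with hp
  have hgen : m₁ ⊔ m₂ = MeasurableSpace.generateFrom p := by
    refine le_antisymm (sup_le (fun s hs => ?_) (fun s hs => ?_))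
      (MeasurableSpace.generateFrom_le ?_)
    · exact MeasurableSpace.measurableSet_generateFrom
        ⟨s, Set.univ, hs, MeasurableSet.univ, (Set.inter_univ s).symm⟩
    · exact MeasurableSpace.measurableSet_generateFrom
        ⟨Set.univ, s, MeasurableSet.univ, hs, (Set.univ_inter s).symm⟩
    · rintro s ⟨a, b, ha, hb, rfl⟩
      exact MeasurableSet.inter (m := m₁ ⊔ m₂) ((le_sup_left : m₁ ≤ m₁ ⊔ m₂) a ha)
        ((le_sup_right : m₂ ≤ m₁ ⊔ m₂) b hb)
  have hpi : IsPiSystem p := by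
    rintro s ⟨a, b, ha, hb, rfl⟩ t ⟨a', b', ha', hb', rfl⟩ -
    exact ⟨a ∩ a', b ∩ b', ha.inter ha', hb.inter hb', Set.inter_inter_inter_comm _ _ _ _⟩
  refine IndepSets.indep (sup_le h₁ h₂) h₃ hpi (@MeasurableSpace.isPiSystem_measurableSet Ω m₃)
    hgen (@MeasurableSpace.generateFrom_measurableSet Ω m₃).symm ?_
  rw [IndepSets_iff]
  rintro s c ⟨a, b, ha, hb, rfl⟩ hc
  have hb' : MeasurableSet[m₂ ⊔ m₃] b := (le_sup_left : m₂ ≤ m₂ ⊔ m₃) b hb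
  have hc' : MeasurableSet[m₂ ⊔ m₃] c := (le_sup_right : m₃ ≤ m₂ ⊔ m₃) c hc
  rw [Indep_iff] at h h'
  rw [Set.inter_assoc, h a (b ∩ c) ha (MeasurableSet.inter (m := m₂ ⊔ m₃) hb' hc'), h' b c hb hc,
    h a b ha hb', mul_assoc]

/-- The law of large numbers for predictable transforms of identically distributed integrable
centred variables, each independent of its past. -/
lemma ae_tendsto_sum_predictable_div {Ω : Type*} [mΩ : MeasurableSpace Ω] {μ : Measure Ω}
    [IsProbabilityMeasure μ] {m : ℕ → MeasurableSpace Ω} (hm : ∀ n, m n ≤ mΩ) (hmono : Monotone m)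
    {A Z : ℕ → Ω → ℝ} (hA : ∀ n, Measurable[m n] (A n)) (hZ : ∀ n, Measurable[m (n + 1)] (Z n))
    (hind : ∀ n, Indep (m n) (MeasurableSpace.comap (Z n) inferInstance) μ)
    (hA1 : ∀ n ω, |A n ω| ≤ 1) (hint : Integrable (Z 0) μ)
    (hident : ∀ n, IdentDistrib (Z n) (Z 0) μ μ) (hmean : ∫ ω, Z 0 ω ∂μ = 0) :
    ∀ᵐ ω ∂μ, Tendsto (fun n : ℕ => (∑ i ∈ Finset.range n, A i ω * Z i ω) / n) atTop (𝓝 0) := by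
  -- `τ K` is the function that `truncation` composes with, so independence and equality of laws
  -- pass to the truncated variables.
  set τ : ℝ → ℝ → ℝ := fun K => Set.indicator (Set.Ioc (-K) K) id with hτ
  have hτm : ∀ K, Measurable (τ K) := fun K => measurable_id.indicator measurableSet_Ioc
  have hZm : ∀ n, Measurable (Z n) := fun n => (hZ n).mono (hm _) le_rfl
  have hpair : ∀ i j, i < j → IndepFun (Z i) (Z j) μ := fun i j hij => by
    rw [IndepFun_iff_Indep]
    exact indep_of_indep_of_le_left (hind j) (((hZ i).mono (hmono hij) le_rfl).comap_le)
  have hbdd : ∀ K : ℕ, ∀ᵐ ω ∂μ, Tendsto (fun n : ℕ => (∑ i ∈ Finset.range n, A i ω *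
      (truncation (Z i) K ω - ∫ ω', truncation (Z 0) K ω' ∂μ)) / n) atTop (𝓝 0) := fun K => by
    set e := ∫ ω', truncation (Z 0) K ω' ∂μ
    have hφ : Measurable fun x => τ K x - e := (hτm K).sub_const e
    refine ae_tendsto_sum_predictable_div_of_bounded hm hmono hA
      (fun n => hφ.comp (hZ n)) (fun n => ?_) hA1 (C := K + |e|) (fun n ω => ?_) (fun n => ?_)
    · refine indep_of_indep_of_le_right (hind n) ?_
      exact Measurable.comap_le (hφ.comp (comap_measurable (Z n)))
    · have := abs_truncation_le_bound (Z n) K ω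
      rw [Nat.abs_cast] at this
      exact (abs_sub _ _).trans (by gcongr)
    · rw [integral_sub (hZm n).aestronglyMeasurable.integrable_truncation (integrable_const _),
        (hident n).truncation.integral_eq]
      simp [e]
  -- The absolute values remove the factors `A i`, leaving pairwise independent, identically
  -- distributed terms.
  have htail : ∀ K : ℕ, ∀ᵐ ω ∂μ, Tendsto (fun n : ℕ => (∑ i ∈ Finset.range n,
      |Z i ω - truncation (Z i) K ω|) / n) atTop (𝓝 (∫ ω, |Z 0 ω - truncation (Z 0) K ω| ∂μ)) :=
    fun K => by
    have hφ : Measurable fun x => |x - τ K x| := (measurable_id.sub (hτm K)).abs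
    refine strong_law_ae_real (fun i ω => |Z i ω - truncation (Z i) K ω|)
      (hint.sub (hZm 0).aestronglyMeasurable.integrable_truncation).abs (fun i j hij => ?_)
      (fun i => (hident i).comp hφ)
    rcases lt_or_gt_of_ne hij with h | h
    · exact (hpair i j h).comp hφ hφ
    · exact (hpair j i h).symm.comp hφ hφ
  have hT : Tendsto (fun K : ℕ => ∫ ω, |Z 0 ω - truncation (Z 0) K ω| ∂μ) atTop (𝓝 0) := by
    have h := tendsto_integral_filter_of_dominated_convergence (μ := μ) (l := atTop)
      (F := fun (K : ℕ) ω => |Z 0 ω - truncation (Z 0) K ω|) (f := fun _ => (0 : ℝ))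
      (fun ω => |Z 0 ω| + |Z 0 ω|)
      (Eventually.of_forall fun K =>
        ((hint.sub (hZm 0).aestronglyMeasurable.integrable_truncation).abs).aestronglyMeasurable)
      (Eventually.of_forall fun K => Eventually.of_forall fun ω => by
        rw [Real.norm_eq_abs, abs_abs]
        exact (abs_sub _ _).trans (add_le_add_right (abs_truncation_le_abs_self _ _ _) _))
      (hint.abs.add hint.abs)
      (Eventually.of_forall fun ω => by
        refine tendsto_const_nhds.congr' ?_
        filter_upwards [tendsto_natCast_atTop_atTop.eventually (eventually_gt_atTop |Z 0 ω|)]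
          with K hK
        rw [truncation_eq_self hK]; simp)
    simpa using h
  have he : Tendsto (fun K : ℕ => |∫ ω, truncation (Z 0) K ω ∂μ|) atTop (𝓝 0) := by
    have h := ((tendsto_integral_truncation hint).comp
      (tendsto_natCast_atTop_atTop (R := ℝ))).abs
    simpa [hmean, Function.comp_def] using h
  filter_upwards [ae_all_iff.2 hbdd, ae_all_iff.2 htail] with ω h1 h2
  rw [Metric.tendsto_nhds]
  intro ε hε
  -- Budget of quarters of ε: one for the centred bounded part, one for the truncated mean, two for
  -- the tail (its limit and the deviation from it).
  obtain ⟨K, hK1, hK2⟩ := ((hT.eventually (gt_mem_nhds (by positivity : 0 < ε / 4))).and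
    (he.eventually (gt_mem_nhds (by positivity : 0 < ε / 4)))).exists
  have h1' := (Metric.tendsto_nhds.1 (h1 K)) (ε / 4) (by positivity)
  have h2' := (h2 K).eventually (gt_mem_nhds (lt_add_of_pos_right _ (by positivity : 0 < ε / 4)))
  filter_upwards [h1', h2', eventually_gt_atTop 0] with n hn1 hn2 hn
  have hn' : (0 : ℝ) < n := by exact_mod_cast hn
  rw [dist_zero_right, Real.norm_eq_abs] at hn1 ⊢
  set e := ∫ ω, truncation (Z 0) K ω ∂μ
  have hsplit : ∑ i ∈ Finset.range n, A i ω * Z i ω =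
      ∑ i ∈ Finset.range n, A i ω * (truncation (Z i) K ω - e) +
      (∑ i ∈ Finset.range n, A i ω * e +
       ∑ i ∈ Finset.range n, A i ω * (Z i ω - truncation (Z i) K ω)) := by
    rw [← Finset.sum_add_distrib, ← Finset.sum_add_distrib]
    exact Finset.sum_congr rfl fun i _ => by ring
  have hb2 : |∑ i ∈ Finset.range n, A i ω * e| ≤ n * |e| := by
    calc _ ≤ ∑ i ∈ Finset.range n, |A i ω * e| := Finset.abs_sum_le_sum_abs _ _
      _ ≤ ∑ i ∈ Finset.range n, |e| := Finset.sum_le_sum fun i _ => by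
          rw [abs_mul]; exact mul_le_of_le_one_left (abs_nonneg _) (hA1 i ω)
      _ = n * |e| := by simp
  have hb3 : |∑ i ∈ Finset.range n, A i ω * (Z i ω - truncation (Z i) K ω)| ≤
      ∑ i ∈ Finset.range n, |Z i ω - truncation (Z i) K ω| := by
    refine (Finset.abs_sum_le_sum_abs _ _).trans (Finset.sum_le_sum fun i _ => ?_)
    rw [abs_mul]; exact mul_le_of_le_one_left (abs_nonneg _) (hA1 i ω)
  rw [abs_div, Nat.abs_cast, div_lt_iff₀ hn'] at hn1 ⊢
  rw [div_lt_iff₀ hn'] at hn2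
  have h3 : n * |e| ≤ n * (ε / 4) := by gcongr
  have h4 : (∫ ω, |Z 0 ω - truncation (Z 0) K ω| ∂μ + ε / 4) * n ≤ (ε / 4 + ε / 4) * n := by gcongr
  rw [hsplit]
  refine (abs_add_le _ _).trans_lt ?_
  have h5 := abs_add_le (∑ i ∈ Finset.range n, A i ω * e)
    (∑ i ∈ Finset.range n, A i ω * (Z i ω - truncation (Z i) K ω))
  linarith

/-! ### Signed errors and margins -/

namespace NoisyPerceptron

variable {k N : ℕ}

/-- The signed error `c - f(x)` of a classifier on an example. -/
noncomputable def Params.error (p : Params k) (x : EuclideanSpace ℝ (Fin k)) (c : Fin 2) : ℝ :=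
  ((c : ℕ) : ℝ) - ((p.classify x : ℕ) : ℝ)

lemma step_params_w (s : LoopState k) (x x' : EuclideanSpace ℝ (Fin k)) (c : Fin 2) :
    (step s x x' c).params.w = s.params.w + s.params.error x c • x' := by
  unfold step Params.error
  by_cases h : s.params.classify x = c <;> simp [h]

lemma step_params_b (s : LoopState k) (x x' : EuclideanSpace ℝ (Fin k)) (c : Fin 2) :
    (step s x x' c).params.b = s.params.b + s.params.error x c := by
  unfold step Params.error
  by_cases h : s.params.classify x = c <;> simp [h]

lemma classify_eq_one_iff (p : Params k) (x : EuclideanSpace ℝ (Fin k)) :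
    p.classify x = 1 ↔ 0 < inner ℝ p.w x + p.b := by
  unfold Params.classify
  split_ifs with h <;> simp [h]

lemma classify_eq_zero_iff (p : Params k) (x : EuclideanSpace ℝ (Fin k)) :
    p.classify x = 0 ↔ inner ℝ p.w x + p.b ≤ 0 := by
  unfold Params.classify
  split_ifs with h
  · simpa using h
  · simpa using h

lemma error_cases (p : Params k) (x : EuclideanSpace ℝ (Fin k)) (c : Fin 2) :
    (p.error x c = 0 ∧ p.classify x = c) ∨
    (p.error x c = 1 ∧ c = 1 ∧ inner ℝ p.w x + p.b ≤ 0) ∨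
    (p.error x c = -1 ∧ c = 0 ∧ 0 < inner ℝ p.w x + p.b) := by
  rw [← classify_eq_one_iff, ← classify_eq_zero_iff]
  unfold Params.error
  generalize p.classify x = d
  fin_cases c <;> fin_cases d <;> simp

lemma abs_error_le_one (p : Params k) (x : EuclideanSpace ℝ (Fin k)) (c : Fin 2) :
    |p.error x c| ≤ 1 := by
  rcases error_cases p x c with h | h | h <;> simp [h.1]

/-- An update occurs only when the activation has the wrong sign, or vanishes. -/
lemma error_mul_activation_nonpos (p : Params k) (x : EuclideanSpace ℝ (Fin k)) (c : Fin 2) :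
    p.error x c * (inner ℝ p.w x + p.b) ≤ 0 := by
  rcases error_cases p x c with h | h | h
  · simp [h.1]
  · rw [h.1, one_mul]; exact h.2.2
  · rw [h.1]; linarith [h.2.2]

/-- `D` is separated by `p` with margin `γ`. -/
def Params.Separates (p : Params k) (D : TrainingSet k N) (γ : ℝ) : Prop :=
  ∀ i, γ ≤ (2 * (((D.c i : ℕ) : ℝ)) - 1) * (inner ℝ p.w (D.x i) + p.b)

/-- A correct classifier of a finite training set can be shifted to one with a positive margin. -/
lemma Params.Correct.exists_separates {p : Params k} {D : TrainingSet k N} (hp : p.Correct D) :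
    ∃ p' : Params k, ∃ γ > 0, p'.Separates D γ := by
  -- Lowering the bias by ε must leave class 1 a margin ε, hence the factor 2; class 0 has
  -- activation at most 0 and gains ε.
  have hε : ∃ ε > 0, ∀ i, D.c i = 1 → 2 * ε ≤ inner ℝ p.w (D.x i) + p.b := by
    have h : ∀ᶠ ε : ℝ in 𝓝[>] 0, ∀ i, D.c i = 1 → 2 * ε ≤ inner ℝ p.w (D.x i) + p.b := by
      refine eventually_all.2 fun i => ?_
      by_cases hi : D.c i = 1
      · have hpos := (classify_eq_one_iff p (D.x i)).1 ((hp i).trans hi)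
        have : ∀ᶠ ε : ℝ in 𝓝 0, 2 * ε < inner ℝ p.w (D.x i) + p.b := by
          have ht : Tendsto (fun ε : ℝ => 2 * ε) (𝓝 0) (𝓝 0) := by
            simpa using (continuous_const_mul (2 : ℝ)).tendsto 0
          exact ht.eventually (gt_mem_nhds hpos)
        exact (this.filter_mono nhdsWithin_le_nhds).mono fun ε hε _ => hε.le
      · exact Eventually.of_forall fun ε hi' => absurd hi' hi
    obtain ⟨ε, h1, h2⟩ := (h.and self_mem_nhdsWithin).exists
    exact ⟨ε, h2, h1⟩
  obtain ⟨ε, hε, h⟩ := hε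
  refine ⟨⟨p.w, p.b - ε⟩, ε, hε, fun i => ?_⟩
  have hc : D.c i = 0 ∨ D.c i = 1 := by
    generalize D.c i = c
    fin_cases c <;> simp
  rcases hc with hc | hc
  · have := (classify_eq_zero_iff p (D.x i)).1 ((hp i).trans hc)
    simp only [hc]
    norm_num
    linarith
  · have := h i hc
    simp only [hc]
    norm_num
    linarith

lemma Params.Separates.margin_le {p : Params k} {D : TrainingSet k N} {γ : ℝ}
    (h : p.Separates D γ) (q : Params k) (i : Fin N) :
    γ * |q.error (D.x i) (D.c i)| ≤
      q.error (D.x i) (D.c i) * (inner ℝ p.w (D.x i) + p.b) := by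
  have hi := h i
  rcases error_cases q (D.x i) (D.c i) with h' | h' | h'
  · simp [h'.1]
  · rw [h'.2.1] at hi
    rw [h'.1]
    norm_num at hi ⊢
    linarith
  · rw [h'.2.1] at hi
    rw [h'.1]
    norm_num at hi ⊢
    linarith

/-! ### The perceptron estimates for denoised weights -/

/-- The parameters after each single example, when the examples `e 0, e 1, …` are processed
without ever halting and the `q`-th update uses the noise vector `ζ q`. -/
noncomputable def paramSeq (D : TrainingSet k N) (e : ℕ → Fin N) (ζ : ℕ → EuclideanSpace ℝ (Fin k)) :
    ℕ → Params k
  | 0 => ⟨0, 0⟩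
  | q + 1 => (step ⟨paramSeq D e ζ q, 0⟩ (D.x (e q)) (D.x (e q) + ζ q) (D.c (e q))).params

/-- The signed errors met along `paramSeq`. -/
noncomputable def errorSeq (D : TrainingSet k N) (e : ℕ → Fin N) (ζ : ℕ → EuclideanSpace ℝ (Fin k)) (q : ℕ) : ℝ :=
  (paramSeq D e ζ q).error (D.x (e q)) (D.c (e q))

/-- The accumulated noise along `paramSeq`. -/
noncomputable def noiseSum (D : TrainingSet k N) (e : ℕ → Fin N) (ζ : ℕ → EuclideanSpace ℝ (Fin k)) (q : ℕ) :
    EuclideanSpace ℝ (Fin k) :=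
  ∑ l ∈ Finset.range q, errorSeq D e ζ l • ζ l

section Deterministic

variable (D : TrainingSet k N) (e : ℕ → Fin N) (ζ : ℕ → EuclideanSpace ℝ (Fin k))

lemma paramSeq_succ_w (q : ℕ) : (paramSeq D e ζ (q + 1)).w =
    (paramSeq D e ζ q).w + errorSeq D e ζ q • (D.x (e q) + ζ q) :=
  step_params_w _ _ _ _

lemma paramSeq_succ_b (q : ℕ) : (paramSeq D e ζ (q + 1)).b =
    (paramSeq D e ζ q).b + errorSeq D e ζ q :=
  step_params_b _ _ _ _

lemma denoised_succ (q : ℕ) :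
    (paramSeq D e ζ (q + 1)).w - noiseSum D e ζ (q + 1) =
      ((paramSeq D e ζ q).w - noiseSum D e ζ q) + errorSeq D e ζ q • D.x (e q) := by
  rw [paramSeq_succ_w, noiseSum, Finset.sum_range_succ, ← noiseSum, smul_add]
  abel

lemma margin_le_denoised {p : Params k} {γ : ℝ} (hp : p.Separates D γ) (q : ℕ) :
    γ * ∑ l ∈ Finset.range q, |errorSeq D e ζ l| ≤
      inner ℝ p.w ((paramSeq D e ζ q).w - noiseSum D e ζ q) + p.b * (paramSeq D e ζ q).b := by
  induction q with
  | zero => simp [paramSeq, noiseSum]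
  | succ q ih =>
    have h : γ * |errorSeq D e ζ q| ≤ errorSeq D e ζ q * (inner ℝ p.w (D.x (e q)) + p.b) :=
      hp.margin_le _ _
    rw [Finset.sum_range_succ, denoised_succ, paramSeq_succ_b, inner_add_right, inner_smul_right]
    nlinarith

/-- The cross term has the good sign for the actual `w`; replacing `w` by the denoised weight costs
at most 2R times the norm of the accumulated noise. The quadratic terms give R² + 1. -/
lemma norm_sq_denoised_le {R : ℝ} (hR : ∀ i, ‖D.x i‖ ≤ R) (q : ℕ) :
    ‖(paramSeq D e ζ q).w - noiseSum D e ζ q‖ ^ 2 + (paramSeq D e ζ q).b ^ 2 ≤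
      ∑ l ∈ Finset.range q, (2 * R * ‖noiseSum D e ζ l‖ + (R ^ 2 + 1)) := by
  induction q with
  | zero => simp [paramSeq, noiseSum]
  | succ q ih =>
    rw [Finset.sum_range_succ, denoised_succ, paramSeq_succ_b, norm_add_sq_real, inner_smul_right,
      norm_smul]
    have h : errorSeq D e ζ q * (inner ℝ (paramSeq D e ζ q).w (D.x (e q)) + (paramSeq D e ζ q).b)
      ≤ 0 := error_mul_activation_nonpos _ _ _
    have ha : |errorSeq D e ζ q| ≤ 1 := abs_error_le_one _ _ _
    rw [inner_sub_left]
    set a := errorSeq D e ζ q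
    have hRq := hR (e q)
    have hR0 : 0 ≤ R := (norm_nonneg _).trans hRq
    have hn : -(a * inner ℝ (noiseSum D e ζ q) (D.x (e q))) ≤ R * ‖noiseSum D e ζ q‖ := by
      calc _ ≤ |a * inner ℝ (noiseSum D e ζ q) (D.x (e q))| := neg_le_abs _
        _ = |a| * |inner ℝ (noiseSum D e ζ q) (D.x (e q))| := abs_mul _ _
        _ ≤ 1 * (‖noiseSum D e ζ q‖ * R) := by
            gcongr
            exact (abs_real_inner_le_norm _ _).trans (by gcongr)
        _ = _ := by ring
    have hx : (‖a‖ * ‖D.x (e q)‖) ^ 2 ≤ R ^ 2 := by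
      rw [Real.norm_eq_abs]
      refine pow_le_pow_left₀ (by positivity) ?_ 2
      calc |a| * ‖D.x (e q)‖ ≤ 1 * R := by gcongr
        _ = R := one_mul R
    have ha2 : a ^ 2 ≤ 1 := (sq_le_one_iff_abs_le_one a).2 ha
    nlinarith

/-- If the accumulated noise is sublinear and `D` is separable, then updates cannot go on with a
positive density. -/
lemma not_forall_le_sum_abs_errorSeq {p : Params k} {γ : ℝ} (hγ : 0 < γ) (hp : p.Separates D γ)
    (hS : Tendsto (fun q : ℕ => ‖noiseSum D e ζ q‖ / q) atTop (𝓝 0)) :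
    ¬ ∀ m : ℕ, (m : ℝ) ≤ ∑ l ∈ Finset.range (m * N), |errorSeq D e ζ l| := by
  intro hK
  obtain ⟨R, hR⟩ : ∃ R, ∀ i, ‖D.x i‖ ≤ R := by
    obtain ⟨R, hR⟩ := (Set.finite_range fun i => ‖D.x i‖).bddAbove
    exact ⟨R, fun i => hR ⟨i, rfl⟩⟩
  have hR0 : 0 ≤ R := (norm_nonneg _).trans (hR (e 0))
  set B := ‖p.w‖ ^ 2 + p.b ^ 2 with hB
  have hB0 : 0 ≤ B := by positivity
  -- Chosen so that the part of the final bound quadratic in `m` takes at most half of γ²; the `+ 1`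
  -- keeps the denominator positive.
  set ε := γ ^ 2 / (4 * (B * N ^ 2 * R + 1)) with hε
  have hε0 : 0 < ε := by positivity
  have hεb : 2 * B * N ^ 2 * R * ε ≤ γ ^ 2 / 2 := by
    rw [hε, mul_div_assoc', div_le_div_iff₀ (by positivity) (by norm_num)]
    nlinarith [sq_nonneg γ]
  -- `C` absorbs the finitely many indices before sublinearity takes effect.
  obtain ⟨C, hC0, hC⟩ : ∃ C, 0 ≤ C ∧ ∀ q, ‖noiseSum D e ζ q‖ ≤ ε * q + C := by
    obtain ⟨q₀, hq₀⟩ := eventually_atTop.1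
      ((hS.eventually (gt_mem_nhds hε0)).and (eventually_gt_atTop 0))
    refine ⟨∑ q ∈ Finset.range q₀, ‖noiseSum D e ζ q‖, by positivity, fun q => ?_⟩
    rcases lt_or_ge q q₀ with h | h
    · have := Finset.single_le_sum (f := fun q => ‖noiseSum D e ζ q‖)
        (fun i _ => norm_nonneg _) (Finset.mem_range.2 h)
      have h' : 0 ≤ ε * q := by positivity
      linarith
    · obtain ⟨h1, h2⟩ := hq₀ q h
      rw [div_lt_iff₀ (by exact_mod_cast h2)] at h1
      have : 0 ≤ ∑ q ∈ Finset.range q₀, ‖noiseSum D e ζ q‖ := by positivity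
      linarith
  set M := B * N * (2 * R * C + (R ^ 2 + 1)) with hM
  obtain ⟨m, hm⟩ := exists_nat_gt (2 * M / γ ^ 2)
  have hm0 : (0 : ℝ) < m := lt_of_le_of_lt (by positivity) hm
  rw [div_lt_iff₀ (by positivity)] at hm
  have h1 := margin_le_denoised D e ζ hp (m * N)
  have h2 := norm_sq_denoised_le D e ζ hR (m * N)
  set v := (paramSeq D e ζ (m * N)).w - noiseSum D e ζ (m * N)
  set b := (paramSeq D e ζ (m * N)).b
  have h3 : γ * m ≤ inner ℝ p.w v + p.b * b := (by gcongr; exact hK m : _ ≤ _).trans h1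
  -- Cauchy-Schwarz for the pairs (w, b) in ℝᵏ × ℝ.
  have h4 : (inner ℝ p.w v + p.b * b) ^ 2 ≤ B * (‖v‖ ^ 2 + b ^ 2) := by
    have hi := abs_real_inner_le_norm p.w v
    have h5 : |inner ℝ p.w v + p.b * b| ≤ ‖p.w‖ * ‖v‖ + |p.b| * |b| :=
      (abs_add_le _ _).trans (add_le_add hi (abs_mul _ _).le)
    calc (inner ℝ p.w v + p.b * b) ^ 2 = |inner ℝ p.w v + p.b * b| ^ 2 := (sq_abs _).symm
      _ ≤ (‖p.w‖ * ‖v‖ + |p.b| * |b|) ^ 2 := pow_le_pow_left₀ (abs_nonneg _) h5 2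
      _ ≤ (‖p.w‖ ^ 2 + |p.b| ^ 2) * (‖v‖ ^ 2 + |b| ^ 2) := by
          nlinarith [sq_nonneg (‖p.w‖ * |b| - |p.b| * ‖v‖)]
      _ = B * (‖v‖ ^ 2 + b ^ 2) := by rw [sq_abs, sq_abs]
  have h6 : ‖v‖ ^ 2 + b ^ 2 ≤ m * N * (2 * R * (ε * (m * N) + C) + (R ^ 2 + 1)) := by
    refine h2.trans ?_
    calc _ ≤ ∑ l ∈ Finset.range (m * N), (2 * R * (ε * (m * N) + C) + (R ^ 2 + 1)) := by
          refine Finset.sum_le_sum fun l hl => ?_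
          have hl' : (l : ℝ) ≤ m * N := by exact_mod_cast (Finset.mem_range.1 hl).le
          gcongr
          exact (hC l).trans (by gcongr)
      _ = _ := by rw [Finset.sum_const, Finset.card_range, nsmul_eq_mul]; push_cast; ring
  have h7 : (γ * m) ^ 2 ≤ B * (m * N * (2 * R * (ε * (m * N) + C) + (R ^ 2 + 1))) :=
    (pow_le_pow_left₀ (by positivity) h3 2).trans (h4.trans (by gcongr))
  have h8 : γ ^ 2 * m ≤ 2 * B * N ^ 2 * R * ε * m + M := by
    refine le_of_mul_le_mul_right ?_ hm0
    calc γ ^ 2 * m * m = (γ * m) ^ 2 := by ring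
      _ ≤ _ := h7
      _ = _ := by rw [hM]; ring
  have h9 : 2 * B * N ^ 2 * R * ε * m ≤ γ ^ 2 / 2 * m := by gcongr
  linarith

end Deterministic

end NoisyPerceptron

/-! ### Loops, halting and the flattened run -/

lemma List.foldl_finRange_induction {α : Type*} {N : ℕ} (f : α → Fin N → α) (a : α)
    (Q : ℕ → α → Prop) (h0 : Q 0 a) (hs : ∀ (i : Fin N) s, Q i s → Q (i + 1) (f s i)) :
    Q N ((List.finRange N).foldl f a) := by
  induction N with
  | zero => simpa using h0
  | succ N ih =>
    rw [List.finRange_succ_last, List.foldl_append, List.foldl_map]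
    exact hs (Fin.last N) _ (ih (fun s i => f s i.castSucc) fun i s h => hs i.castSucc s h)

lemma Fin.xor_xor_cancel_right {n : ℕ} (i u : Fin (2 ^ n)) : i ^^^ u ^^^ u = i := by
  ext
  simp

namespace NoisyPerceptron

variable {k N : ℕ}

/-- A pass through the examples `σ 0, σ 1, …` without an update leaves the parameters unchanged,
and these classify all the examples met correctly. -/
lemma foldl_step_correct (D : TrainingSet k N) (σ : Fin N → Fin N) (hσ : Function.Surjective σ)
    (x' : Fin N → EuclideanSpace ℝ (Fin k)) (p : Params k)
    (h : ((List.finRange N).foldl (fun s i => step s (D.x (σ i)) (x' i) (D.c (σ i))) ⟨p, 0⟩).Δ = 0) :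
    ((List.finRange N).foldl (fun s i => step s (D.x (σ i)) (x' i) (D.c (σ i)))
      ⟨p, 0⟩).params.Correct D := by
  have key := List.foldl_finRange_induction
    -- The invariant is conditional on a zero counter: an update makes the counter positive for
    -- good.
    (fun s i => step s (D.x (σ i)) (x' i) (D.c (σ i))) (⟨p, 0⟩ : LoopState k)
    (fun j s => s.Δ = 0 → s.params = p ∧ ∀ i : Fin N, (i : ℕ) < j →
      p.classify (D.x (σ i)) = D.c (σ i)) (fun _ => ⟨rfl, fun i hi => absurd hi (by simp)⟩)
    (fun i s ih hΔ => by
      by_cases hc : s.params.classify (D.x (σ i)) = D.c (σ i)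
      · have hst : step s (D.x (σ i)) (x' i) (D.c (σ i)) = s := by simp [step, hc]
        rw [hst] at hΔ ⊢
        obtain ⟨hp, hi⟩ := ih hΔ
        refine ⟨hp, fun j hj => ?_⟩
        rcases Nat.lt_succ_iff_lt_or_eq.1 hj with hj | hj
        · exact hi j hj
        · rw [Fin.ext hj, ← hp]; exact hc
      · simp [step, hc] at hΔ)
  obtain ⟨hp, hi⟩ := key h
  rw [hp]
  intro j
  obtain ⟨i, rfl⟩ := hσ j
  exact hi i i.2

/-- If a loop without updates yields a correct classifier, then so does a halted run. -/
lemma correct_of_halted {D : TrainingSet k N} {loop : ℕ → Params k → LoopState k}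
    (hloop : ∀ m p, (loop m p).Δ = 0 → (loop m p).params.Correct D) (T : ℕ)
    (h : (runLoops loop T).halted = true) : (runLoops loop T).params.Correct D := by
  induction T with
  | zero => simp [runLoops] at h
  | succ T ih =>
    by_cases hT : (runLoops loop T).halted = true
    · simp only [runLoops, hT, if_true]
      exact ih hT
    · simp only [runLoops, hT] at h ⊢
      exact hloop _ _ (by simpa using h)

lemma originalRun_correct {D : TrainingSet k N} {T : ℕ} (h : (originalRun D T).halted = true) :
    (originalRun D T).params.Correct D :=
  correct_of_halted (fun _ p hp => foldl_step_correct D id Function.surjective_id D.x p hp) T h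

lemma noisyRun_correct {n : ℕ} {D : TrainingSet k (2 ^ n)} {u : ℕ → Fin (2 ^ n)}
    {r : ℕ → Fin (2 ^ n) → EuclideanSpace ℝ (Fin k)} {T : ℕ}
    (h : (noisyRun D u r T).halted = true) : (noisyRun D u r T).params.Correct D :=
  correct_of_halted (fun m p hp => foldl_step_correct D (· ^^^ u m)
    (fun j => ⟨j ^^^ u m, Fin.xor_xor_cancel_right j (u m)⟩) _ p hp) T h

lemma step_Δ (s : LoopState k) (x x' : EuclideanSpace ℝ (Fin k)) (c : Fin 2) :
    (((step s x x' c).Δ : ℕ) : ℝ) = s.Δ + |s.params.error x c| := by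
  rcases error_cases s.params x c with h | h | h
  · simp [step, h.1, h.2]
  · have : s.params.classify x ≠ c := fun hc => by simp [Params.error, hc] at h
    simp [step, h.1, this]
  · have : s.params.classify x ≠ c := fun hc => by simp [Params.error, hc] at h
    simp [step, h.1, this]

/-- Needed because `paramSeq` resets the counter at every example while a loop accumulates it. -/
lemma step_params_congr {s t : LoopState k} (h : s.params = t.params)
    (x x' : EuclideanSpace ℝ (Fin k)) (c : Fin 2) :
    (step s x x' c).params = (step t x x' c).params := by
  ext1 <;> simp [step_params_w, step_params_b, h]

/-- The example visited at the `q`-th inner iteration of the noisy perceptron, counted over all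
loops. -/
def visited {n : ℕ} (u : ℕ → Fin (2 ^ n)) (q : ℕ) : Fin (2 ^ n) :=
  (Nat.divModEquiv (2 ^ n) q).2 ^^^ u (Nat.divModEquiv (2 ^ n) q).1

/-- The noise vector drawn at the `q`-th inner iteration, counted over all loops. -/
def flatNoise {n : ℕ} {α : Type*} (r : ℕ → Fin (2 ^ n) → α) (q : ℕ) : α :=
  r (Nat.divModEquiv (2 ^ n) q).1 (Nat.divModEquiv (2 ^ n) q).2

lemma divModEquiv_mul_add {N : ℕ} [NeZero N] (m : ℕ) (i : Fin N) :
    Nat.divModEquiv N (m * N + i) = (m, i) :=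
  (Nat.divModEquiv N).apply_symm_apply (m, i)

section Loops

variable {n : ℕ} (D : TrainingSet k (2 ^ n)) (u : ℕ → Fin (2 ^ n))
  (r : ℕ → Fin (2 ^ n) → EuclideanSpace ℝ (Fin k))

lemma noisyLoop_paramSeq (m : ℕ) :
    (noisyLoop D (u m) (r m) (paramSeq D (visited u) (flatNoise r) (m * 2 ^ n))).params =
      paramSeq D (visited u) (flatNoise r) ((m + 1) * 2 ^ n) ∧
    ((noisyLoop D (u m) (r m) (paramSeq D (visited u) (flatNoise r) (m * 2 ^ n))).Δ : ℝ) =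
      ∑ l ∈ Finset.range (2 ^ n), |errorSeq D (visited u) (flatNoise r) (m * 2 ^ n + l)| := by
  rw [Nat.add_one_mul]
  refine List.foldl_finRange_induction
    (fun s i => step s (D.x (i ^^^ u m)) (D.x (i ^^^ u m) + r m i) (D.c (i ^^^ u m))) _
    (fun j s => s.params = paramSeq D (visited u) (flatNoise r) (m * 2 ^ n + j) ∧
      (s.Δ : ℝ) = ∑ l ∈ Finset.range j, |errorSeq D (visited u) (flatNoise r) (m * 2 ^ n + l)|)
    (by simp) ?_
  rintro i s ⟨h1, h2⟩
  have hv : visited u (m * 2 ^ n + i) = i ^^^ u m := by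
    rw [visited, divModEquiv_mul_add]
  have hz : flatNoise r (m * 2 ^ n + i) = r m i := by
    rw [flatNoise, divModEquiv_mul_add]
  constructor
  · rw [← add_assoc, paramSeq, hv, hz]
    exact step_params_congr h1 _ _ _
  · rw [step_Δ, h2, Finset.sum_range_succ, h1, errorSeq, hv]

/-- Each loop that fails to halt the run adds at least one nonzero error. The parameters are carried
along because the run agrees with `paramSeq` only as long as it has not halted. -/
lemma le_sum_abs_errorSeq_of_not_halted (h : ∀ T, (noisyRun D u r T).halted = false) (m : ℕ) :
    (noisyRun D u r m).params = paramSeq D (visited u) (flatNoise r) (m * 2 ^ n) ∧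
    (m : ℝ) ≤ ∑ l ∈ Finset.range (m * 2 ^ n), |errorSeq D (visited u) (flatNoise r) l| := by
  induction m with
  | zero => simp [noisyRun, runLoops, paramSeq]
  | succ m ih =>
    have hm := h m
    have hm1 := h (m + 1)
    simp only [noisyRun] at hm hm1 ih
    simp only [noisyRun, runLoops, hm, ih.1, Bool.false_eq_true, if_false] at hm1 ⊢
    obtain ⟨h1, h2⟩ := noisyLoop_paramSeq D u r m
    refine ⟨h1, ?_⟩
    rw [Nat.add_one_mul, Finset.sum_range_add, ← h2]
    have : 1 ≤ (noisyLoop D (u m) (r m)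
        (paramSeq D (visited u) (flatNoise r) (m * 2 ^ n))).Δ :=
      Nat.one_le_iff_ne_zero.2 (by simpa using hm1)
    push_cast
    exact add_le_add ih.2 (by exact_mod_cast this)

/-- On a separable training set the noisy perceptron terminates whenever the noise accumulated by
its updates is sublinear in the number of iterations. -/
lemma exists_halted_of_tendsto_noiseSum {p : Params k} (hp : p.Correct D)
    (hS : Tendsto (fun q : ℕ => ‖noiseSum D (visited u) (flatNoise r) q‖ / q) atTop (𝓝 0)) :
    ∃ T, (noisyRun D u r T).halted = true := by
  by_contra! h
  obtain ⟨p', γ, hγ, hp'⟩ := hp.exists_separates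
  exact not_forall_le_sum_abs_errorSeq D _ _ hγ hp' hS fun m =>
    (le_sum_abs_errorSeq_of_not_halted D u r (fun T => by simpa using h T) m).2

end Loops

/-! ### Adaptedness and sublinear noise -/

lemma measurable_error (D : TrainingSet k N) :
    Measurable fun y : (EuclideanSpace ℝ (Fin k) × ℝ) × Fin N =>
      (⟨y.1.1, y.1.2⟩ : Params k).error (D.x y.2) (D.c y.2) := by
  refine measurable_from_prod_countable_left fun i => ?_
  -- For a fixed example the error is a constant minus the indicator of a half-space in (w, b).
  have h : (fun y : EuclideanSpace ℝ (Fin k) × ℝ => (⟨y.1, y.2⟩ : Params k).error (D.x i) (D.c i)) =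
      fun y => ((D.c i : ℕ) : ℝ) - Set.indicator {y | 0 < inner ℝ y.1 (D.x i) + y.2} 1 y := by
    ext y
    by_cases hy : 0 < inner ℝ y.1 (D.x i) + y.2 <;> simp [Params.error, Params.classify, hy]
  rw [h]
  refine measurable_const.sub (measurable_one.indicator ?_)
  exact measurableSet_lt measurable_const ((measurable_fst.inner measurable_const).add measurable_snd)

/-- The parameters and the errors along `paramSeq` are adapted. -/
lemma measurable_paramSeq {Ω : Type*} (D : TrainingSet k N) {m : ℕ → MeasurableSpace Ω}
    (hmono : Monotone m) {e : ℕ → Ω → Fin N} {ζ : ℕ → Ω → EuclideanSpace ℝ (Fin k)}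
    (he : ∀ q, Measurable[m q] (e q)) (hζ : ∀ q, Measurable[m (q + 1)] (ζ q)) (q : ℕ) :
    (Measurable[m q] fun ω => (paramSeq D (e · ω) (ζ · ω) q).w) ∧
    (Measurable[m q] fun ω => (paramSeq D (e · ω) (ζ · ω) q).b) ∧
    (Measurable[m q] fun ω => errorSeq D (e · ω) (ζ · ω) q) := by
  have herr : ∀ q, (Measurable[m q] fun ω => (paramSeq D (e · ω) (ζ · ω) q).w) →
      (Measurable[m q] fun ω => (paramSeq D (e · ω) (ζ · ω) q).b) →
      (Measurable[m q] fun ω => errorSeq D (e · ω) (ζ · ω) q) := fun q hw hb =>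
    (measurable_error D).comp ((hw.prodMk hb).prodMk (he q))
  suffices h : (Measurable[m q] fun ω => (paramSeq D (e · ω) (ζ · ω) q).w) ∧
      (Measurable[m q] fun ω => (paramSeq D (e · ω) (ζ · ω) q).b) from
    ⟨h.1, h.2, herr q h.1 h.2⟩
  induction q with
  | zero => exact ⟨measurable_const, measurable_const⟩
  | succ q ih =>
    have hle : m q ≤ m (q + 1) := hmono q.le_succ
    have ha := (herr q ih.1 ih.2).mono hle le_rfl
    have hx : Measurable[m (q + 1)] fun ω => D.x (e q ω) :=
      (Measurable.of_discrete (f := D.x)).comp ((he q).mono hle le_rfl)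
    simp only [paramSeq_succ_w, paramSeq_succ_b]
    exact ⟨(ih.1.mono hle le_rfl).add (ha.smul (hx.add (hζ q))), (ih.2.mono hle le_rfl).add ha⟩

lemma _root_.EuclideanSpace.norm_le_sum_abs {ι : Type*} [Fintype ι] (v : EuclideanSpace ℝ ι) :
    ‖v‖ ≤ ∑ j, |v j| := by
  classical
  conv_lhs => rw [← (EuclideanSpace.basisFun ι ℝ).sum_repr v]
  refine (norm_sum_le _ _).trans (le_of_eq ?_)
  simp [norm_smul]

/-- Along the noisy perceptron the accumulated noise is almost surely sublinear. -/
lemma ae_tendsto_noiseSum_div {Ω : Type*} [mΩ : MeasurableSpace Ω] {P : Measure Ω}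
    [IsProbabilityMeasure P] (D : TrainingSet k N) {m : ℕ → MeasurableSpace Ω}
    (hm : ∀ q, m q ≤ mΩ) (hmono : Monotone m) {e : ℕ → Ω → Fin N}
    {ζ : ℕ → Ω → EuclideanSpace ℝ (Fin k)}
    (he : ∀ q, Measurable[m q] (e q)) (hζ : ∀ q, Measurable[m (q + 1)] (ζ q))
    (hind : ∀ q, Indep (m q) (MeasurableSpace.comap (ζ q) inferInstance) P)
    (hint : Integrable (ζ 0) P) (hident : ∀ q, IdentDistrib (ζ q) (ζ 0) P P)
    (hmean : ∫ ω, ζ 0 ω ∂P = 0) :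
    ∀ᵐ ω ∂P, Tendsto (fun q : ℕ => ‖noiseSum D (e · ω) (ζ · ω) q‖ / q) atTop (𝓝 0) := by
  have hcoord : ∀ j, ∀ᵐ ω ∂P, Tendsto (fun q : ℕ =>
      (∑ l ∈ Finset.range q, errorSeq D (e · ω) (ζ · ω) l * ζ l ω j) / q) atTop (𝓝 0) := fun j => by
    set π : EuclideanSpace ℝ (Fin k) →L[ℝ] ℝ := EuclideanSpace.proj j
    have hπ : Measurable π := π.continuous.measurable
    refine ae_tendsto_sum_predictable_div hm hmono
      (A := fun l ω => errorSeq D (e · ω) (ζ · ω) l) (Z := fun l ω => π (ζ l ω))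
      (fun q => (measurable_paramSeq D hmono he hζ q).2.2) (fun q => hπ.comp (hζ q))
      (fun q => ?_) (fun q ω => abs_error_le_one _ _ _) (π.integrable_comp hint)
      (fun q => (hident q).comp hπ) ?_
    · exact indep_of_indep_of_le_right (hind q)
        (Measurable.comap_le (hπ.comp (comap_measurable (ζ q))))
    · rw [π.integral_comp_comm hint, hmean, map_zero]
  filter_upwards [ae_all_iff.2 hcoord] with ω hω
  have hlim : Tendsto (fun q : ℕ => ∑ j, |(∑ l ∈ Finset.range q,
      errorSeq D (e · ω) (ζ · ω) l * ζ l ω j) / q|) atTop (𝓝 0) := by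
    simpa using tendsto_finsetSum Finset.univ fun j _ => (hω j).abs
  refine squeeze_zero (fun q => by positivity) (fun q => ?_) hlim
  simp_rw [abs_div, Nat.abs_cast, ← Finset.sum_div]
  gcongr
  refine (EuclideanSpace.norm_le_sum_abs _).trans (le_of_eq ?_)
  simp [noiseSum]

end NoisyPerceptron

/-! ### The main theorem -/

open NoisyPerceptron

theorem mainTheorem3 {k n : ℕ} (D : NoisyPerceptron.TrainingSet k (2 ^ n))
    {Ω : Type*} [MeasurableSpace Ω] (P : Measure Ω) [IsProbabilityMeasure P]
    -- the bit strings drawn at the beginning of each loop: independent and uniform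
    (u : ℕ → Ω → Fin (2 ^ n))
    (hu_meas : ∀ m, Measurable (u m))
    (hu_unif : ∀ m v, P {ω | u m ω = v} = ((2 : ENNReal) ^ n)⁻¹)
    (hu_indep : iIndepFun u P)
    -- the noise vectors: independent draws from one law `ν` of mean zero
    (ν : Measure (EuclideanSpace ℝ (Fin k)))
    (hν_int : Integrable (fun z => z) ν)
    (hν_mean : ∫ z, z ∂ν = 0)
    (r : ℕ → Fin (2 ^ n) → Ω → EuclideanSpace ℝ (Fin k))
    (hr_meas : ∀ m i, Measurable (r m i))
    (hr_law : ∀ m i, P.map (r m i) = ν)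
    (hr_indep : iIndepFun (fun (q : ℕ × Fin (2 ^ n)) (ω : Ω) => r q.1 q.2 ω) P)
    -- the bit strings and the noise are independent of each other
    (hur_indep : IndepFun (fun ω (m : ℕ) => u m ω)
      (fun ω (q : ℕ × Fin (2 ^ n)) => r q.1 q.2 ω) P)
    -- the original perceptron terminates on `D`
    (hterm : ∃ T, (NoisyPerceptron.originalRun D T).halted = true) :
    (∀ᵐ ω ∂P, ∃ T,
      (NoisyPerceptron.noisyRun D (fun m => u m ω) (fun m i => r m i ω) T).halted = true) ∧
    (∀ ω T,
      (NoisyPerceptron.noisyRun D (fun m => u m ω) (fun m i => r m i ω) T).halted = true →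
      (NoisyPerceptron.noisyRun D (fun m => u m ω) (fun m i => r m i ω) T).params.Correct D) := by
  obtain ⟨T₀, hT₀⟩ := hterm
  have hcorrect := originalRun_correct hT₀
  refine ⟨?_, fun ω T h => noisyRun_correct h⟩
  set φ := Nat.divModEquiv (2 ^ n)
  set ζ : ℕ → Ω → EuclideanSpace ℝ (Fin k) := fun q => r (φ q).1 (φ q).2 with hζ
  set e : ℕ → Ω → Fin (2 ^ n) := fun q ω => visited (fun m => u m ω) q with he
  set U : Ω → ℕ → Fin (2 ^ n) := fun ω m => u m ω with hU
  -- All bit strings are revealed at time 0, so only noise enters later; the index of each example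
  -- is then known before its noise vector.
  set m : ℕ → MeasurableSpace Ω := fun q => MeasurableSpace.comap U inferInstance ⊔
    ⨆ l ∈ Set.Iio q, MeasurableSpace.comap (ζ l) inferInstance with hm
  have hζm : ∀ q, Measurable (ζ q) := fun q => hr_meas _ _
  have hUm : Measurable U := measurable_pi_iff.2 hu_meas
  have hle : ∀ q, m q ≤ ‹MeasurableSpace Ω› := fun q =>
    sup_le hUm.comap_le (iSup₂_le fun l _ => (hζm l).comap_le)
  have hmono : Monotone m := fun a b hab =>
    sup_le_sup_left (biSup_mono fun l hl => lt_of_lt_of_le hl hab) _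
  have hem : ∀ q, Measurable[m q] (e q) := fun q => by
    refine Measurable.mono ?_ (le_sup_left : MeasurableSpace.comap U inferInstance ≤ m q) le_rfl
    exact (Measurable.of_discrete (f := fun v => (φ q).2 ^^^ v)).comp
      ((measurable_pi_apply (φ q).1).comp (comap_measurable U))
  have hζa : ∀ q, Measurable[m (q + 1)] (ζ q) := fun q =>
    (comap_measurable (ζ q)).mono ((le_iSup₂_of_le (f := fun l (_ : l ∈ Set.Iio (q + 1)) =>
      MeasurableSpace.comap (ζ l) inferInstance) q q.lt_succ_self le_rfl).trans le_sup_right) le_rfl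
  have hζind : iIndepFun ζ P := hr_indep.precomp φ.injective
  have hind : ∀ q, Indep (m q) (MeasurableSpace.comap (ζ q) inferInstance) P := fun q => by
    -- The strings are independent of the whole noise array, and the past noise of the current
    -- vector.
    refine indep_sup_left_of_indep hUm.comap_le (iSup₂_le fun l _ => (hζm l).comap_le)
      (hζm q).comap_le ?_ ?_
    · have hall : ∀ l, MeasurableSpace.comap (ζ l) inferInstance ≤ MeasurableSpace.comap
          (fun ω (q : ℕ × Fin (2 ^ n)) => r q.1 q.2 ω) inferInstance := fun l =>
        Measurable.comap_le ((measurable_pi_apply (φ l)).comp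
          (comap_measurable fun ω (q : ℕ × Fin (2 ^ n)) => r q.1 q.2 ω))
      exact indep_of_indep_of_le_right ((IndepFun_iff_Indep _ _ _).1 hur_indep)
        (sup_le (iSup₂_le fun l _ => hall l) (hall q))
    · have := indep_iSup_of_disjoint (S := Set.Iio q) (T := {q}) (fun l => (hζm l).comap_le) hζind.iIndep
        (Set.disjoint_singleton_right.2 Set.self_notMem_Iio)
      simpa using this
  have hlaw : ∀ q, P.map (ζ q) = ν := fun q => hr_law _ _
  have hid : AEStronglyMeasurable (fun z => z) (P.map (ζ 0)) := by
    rw [hlaw]; exact hν_int.aestronglyMeasurable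
  have hint : Integrable (ζ 0) P :=
    (integrable_map_measure hid (hζm 0).aemeasurable).1 (by rw [hlaw]; exact hν_int)
  have hmean : ∫ ω, ζ 0 ω ∂P = 0 := by
    rw [← integral_map (hζm 0).aemeasurable hid, hlaw, hν_mean]
  have hident : ∀ q, IdentDistrib (ζ q) (ζ 0) P P := fun q =>
    ⟨(hζm q).aemeasurable, (hζm 0).aemeasurable, by rw [hlaw, hlaw]⟩
  filter_upwards [ae_tendsto_noiseSum_div D hle hmono hem hζa hind hint hident hmean] with ω hω
  exact exists_halted_of_tendsto_noiseSum D _ _ hcorrect hω
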